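/- Let $p,q$ be positive integers with $pq\ge 6$, and let $\Delta^+=\mathbb{Z}_p*\mathbb{Z}_q$ be the free product of the cyclic groups of orders $p$ and $q$. A hypermap on $n$ darts is a triple $\langle D;\alpha,\sigma\rangle$, where $D$ is a set of $n$ elements (the darts) and $\alpha,\sigma$ are permutations of $D$ such that $\langle\alpha,\sigma\rangle$ acts transitively on $D$; put $\varphi=\sigma^{-1}\alpha^{-1}$ (permutations being multiplied from left to right). It is a $(p,q)$-hypermap if all cycles of $\alpha$ have length $p$ and all cycles of $\varphi$ have length $q$ (fixed points being cycles of length $1$), and it is rooted if one dart is marked as its root. Two rooted hypermaps are identified if some bijection of their darts conjugates $\alpha$ to $\alpha$ and $\sigma$ to $\sigma$ and takes root to root; let $\mathfrak{H}^r_{p,q}(n)$ be the set of rooted $(p,q)$-hypermaps on $n$ darts up to this identification. For every $n \geq 0$ let $s_f(n)$ be the number of free subgroups of index $n$ in $\Delta^+$ (so $s_f(0)=0$). Then all the numbers $s_f(n)$ and $|\mathfrak{H}^r_{p,q}(n)|$ are finite, and the subgroup growth series $S_f(z)=\sum_{n=0}^{\infty}s_f(n)z^n$ coincides with the generating series $$H^\circ(z)=\sum_{n=0}^{\infty}|\mathfrak{H}^r_{p,q}(n)|\,z^n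 .$$ -/

import Mathlib

/-- An oriented combinatorial hypermap with set of darts `D`: two permutations of `D`
generating a group that acts transitively on `D` (so hypermaps are connected).
The orbits of `edge` are the hyper-edges and those of `vertex` are the vertices. -/
structure Hypermap (D : Type) where
  /-- the permutation `α` -/
  edge : Equiv.Perm D
  /-- the permutation `σ` -/
  vertex : Equiv.Perm D
  transitive : MulAction.IsPretransitive
    (Subgroup.closure ({edge, vertex} : Set (Equiv.Perm D))) D

namespace Hypermap

/-- The permutation `φ` whose orbits are the hyper-faces: first `σ⁻¹`, then `α⁻¹`.
(Multiplying permutations from left to right this is `σ⁻¹ α⁻¹`; Mathlib multiplies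
them from right to left.) -/
def face {D : Type} (H : Hypermap D) : Equiv.Perm D :=
  H.edge⁻¹ * H.vertex⁻¹

/-- A `(p,q)`-hypermap: all cycles of `α` have length `p` and all cycles of `φ` have length `q`.
Fixed points count as cycles of length one; the length of the cycle through `d` is the
minimal period of `d`. -/
def IsPQ {D : Type} (p q : ℕ) (H : Hypermap D) : Prop :=
  (∀ d : D, Function.minimalPeriod H.edge d = p) ∧
    (∀ d : D, Function.minimalPeriod H.face d = q)

end Hypermap

/-- A rooted `(p,q)`-hypermap with darts `Fin n`: one dart is marked as the root. -/
structure RootedPQHypermap (p q n : ℕ) where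
  /-- the underlying hypermap -/
  map : Hypermap (Fin n)
  isPQ : map.IsPQ p q
  /-- the marked dart -/
  root : Fin n

namespace RootedPQHypermap

/-- Isomorphism of rooted hypermaps: a bijection of the darts that conjugates the permutations
of one hypermap to those of the other and takes root to root. -/
def Iso {p q n : ℕ} (H₁ H₂ : RootedPQHypermap p q n) : Prop :=
  ∃ ψ : Equiv.Perm (Fin n),
    ψ * H₁.map.edge * ψ⁻¹ = H₂.map.edge ∧
    ψ * H₁.map.vertex * ψ⁻¹ = H₂.map.vertex ∧
    ψ H₁.root = H₂.root

theorem iso_equivalence (p q n : ℕ) :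
    Equivalence (Iso : RootedPQHypermap p q n → RootedPQHypermap p q n → Prop) where
  refl H := ⟨1, by simp, by simp, by simp⟩
  symm := by
    rintro H₁ H₂ ⟨ψ, h₁, h₂, h₃⟩
    refine ⟨ψ⁻¹, ?_, ?_, ?_⟩
    · rw [← h₁]; group
    · rw [← h₂]; group
    · rw [← h₃]; simp
  trans := by
    rintro H₁ H₂ H₃ ⟨ψ, h₁, h₂, h₃⟩ ⟨χ, k₁, k₂, k₃⟩
    refine ⟨χ * ψ, ?_, ?_, ?_⟩
    · rw [← k₁, ← h₁]; group
    · rw [← k₂, ← h₂]; group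
    · rw [← k₃, ← h₃]; simp

/-- Rooted `(p,q)`-hypermaps on `n` labelled darts up to isomorphism. -/
instance isoSetoid (p q n : ℕ) : Setoid (RootedPQHypermap p q n) :=
  ⟨Iso, iso_equivalence p q n⟩

end RootedPQHypermap

/-- The set of connected oriented rooted `(p,q)`-hypermaps on `n` darts
(rooted hypermaps are taken up to isomorphism). -/
def RootedHypermapClass (p q n : ℕ) : Type :=
  Quotient (RootedPQHypermap.isoSetoid p q n)

/-- The free product `ℤ_p * ℤ_q` of two cyclic groups. -/
abbrev CyclicFreeProduct (p q : ℕ) : Type :=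
  Monoid.Coprod (Multiplicative (ZMod p)) (Multiplicative (ZMod q))

/-- The set of free subgroups of (finite) index `n` in `ℤ_p * ℤ_q`.
Mathlib's `index` is `0` on subgroups of infinite index; these are excluded. -/
def freeSubgroupsOfIndex (p q n : ℕ) : Set (Subgroup (CyclicFreeProduct p q)) :=
  {Γ | Γ.FiniteIndex ∧ Γ.index = n ∧ IsFreeGroup Γ}

/-- The subgroup growth series `S_f(z) = ∑ s_f(n) zⁿ`, where `s_f(n)` is the number of
free subgroups of index `n` in `ℤ_p * ℤ_q`. -/
noncomputable def freeSubgroupSeries (p q : ℕ) : PowerSeries ℤ :=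
  PowerSeries.mk fun n => ((freeSubgroupsOfIndex p q n).ncard : ℤ)

/-- The generating series `H°(z)` of the numbers of connected oriented rooted
`(p,q)`-hypermaps on `n` darts. -/
noncomputable def rootedHypermapSeries (p q : ℕ) : PowerSeries ℤ :=
  PowerSeries.mk fun n => (Nat.card (RootedHypermapClass p q n) : ℤ)

/-! A rooted (p,q)-hypermap is a transitive action of G = ℤ_p * ℤ_q on the darts, the generators
acting as α and φ; σ is recovered from these. Up to isomorphism it is determined by the stabilizer
of the root, and darts become cosets. The cycle conditions say that both factors act freely, so it
remains to see that a subgroup Γ is free exactly when both factors act freely on its cosets.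

If Γ is free it is torsion-free, while a coset fixed by an element of a finite factor puts a
conjugate of that element in Γ (`eq_one_of_smul_quotient_eq`).

Conversely, the action groupoid on the set A of cosets is free (`nonempty_isFreeGroupoid`): choose a
base point in each orbit of each factor, and take as generators the nontrivial arrows of that factor
leaving it. Functors to a group X are homomorphisms G → (A → X) ⋊ G over G. These can be prescribed
separately on the two factors, where each is the coboundary of a unique function equal to 1 at the
base points. Γ is a vertex group of this connected groupoid, hence free. -/

/-! ### Free actions of one factor: base points and coboundaries -/

section FreeAction

open CategoryTheory CategoryTheory.ActionCategory

universe u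

variable {P G A X : Type u} [Group P] [Group G] [MulAction G A] [Group X]

/-- A set of base points for the action of `P` through `φ`: every point is reached
from exactly one base point by exactly one group element. -/
def IsBaseSet (φ : P →* G) (B : Set A) : Prop :=
  ∀ x : A, ∃! ga : P × A, ga.2 ∈ B ∧ φ ga.1 • ga.2 = x

theorem exists_isBaseSet (φ : P →* G) (hfree : ∀ (g : P) (x : A), φ g • x = x → g = 1) :
    ∃ B : Set A, IsBaseSet φ B := by
  let _ : MulAction P A := MulAction.compHom A φ
  have smul_def : ∀ (g : P) (x : A), g • x = φ g • x := fun _ _ => rfl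
  let rep : A → A := fun x => (Quotient.mk (MulAction.orbitRel P A) x).out
  have rep_mem : ∀ x, ∃ g : P, g • rep x = x := fun x => by
    have h : (MulAction.orbitRel P A).r (rep x) x := Quotient.exact (Quotient.out_eq _)
    exact (MulAction.orbitRel P A).symm h
  have rep_smul : ∀ (g : P) x, rep (g • x) = rep x := fun g x => by
    have : (Quotient.mk (MulAction.orbitRel P A) (g • x)) = Quotient.mk _ x :=
      Quotient.sound ⟨g, rfl⟩
    exact congrArg Quotient.out this
  refine ⟨Set.range rep, fun x => ?_⟩
  obtain ⟨g, hg⟩ := rep_mem x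
  refine ⟨(g, rep x), ⟨⟨x, rfl⟩, hg⟩, ?_⟩
  rintro ⟨k, _⟩ ⟨⟨y, rfl⟩, hk⟩
  obtain ⟨l, hl⟩ := rep_mem y
  have hrep : rep y = rep x := by
    have h₁ : rep (rep y) = rep y := by rw [← rep_smul l, hl]
    rw [← h₁, ← rep_smul k]
    exact congrArg rep hk
  have hkg : k = g := by
    have : (g⁻¹ * k) • rep x = rep x := by
      rw [mul_smul, inv_smul_eq_iff, hg, ← hrep]; exact hk
    exact (inv_mul_eq_one.mp (hfree _ _ this)).symm
  rw [hkg, hrep]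

/-- The nontrivial arrows of the action groupoid that start at a base point. -/
abbrev BaseEdge (φ : P →* G) (B : Set A) (a b : A) : Type u :=
  {g : P // g ≠ 1 ∧ a ∈ B ∧ φ g • a = b}

open Classical in
/-- The value at `b` of the labelling `f` on the arrow from the base point of `b` to `b`
(and `1` if `b` is a base point). -/
noncomputable def basePotential (φ : P →* G) (B : Set A)
    (f : ∀ a b : A, BaseEdge φ B a b → X) (b : A) : X :=
  if h : Nonempty (Σ a, BaseEdge φ B a b) then f _ _ h.some.2 else 1

/-- Base point and group element are unique, so the arbitrary choice in `basePotential` can only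
return `e`. -/
theorem basePotential_eq {φ : P →* G} {B : Set A} (hB : IsBaseSet φ B)
    (f : ∀ a b : A, BaseEdge φ B a b → X) {a b : A} (e : BaseEdge φ B a b) :
    basePotential φ B f b = f a b e := by
  have h : Nonempty (Σ a, BaseEdge φ B a b) := ⟨⟨a, e⟩⟩
  have hs : h.some = ⟨a, e⟩ := by
    generalize h.some = s
    obtain ⟨a', e'⟩ := s
    have := (hB b).unique (y₁ := (e'.1, a')) (y₂ := (e.1, a)) e'.2.2 e.2.2
    obtain ⟨h₁, rfl⟩ := Prod.ext_iff.mp this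
    rw [Subtype.ext h₁]
  rw [basePotential, dif_pos h, hs]

/-- The identity already carries `a` to itself, so uniqueness excludes a nontrivial arrow into `a`.
-/
theorem basePotential_base {φ : P →* G} {B : Set A} (hB : IsBaseSet φ B)
    (f : ∀ a b : A, BaseEdge φ B a b → X) {a : A} (ha : a ∈ B) :
    basePotential φ B f a = 1 := by
  refine dif_neg ?_
  rintro ⟨⟨a', e⟩⟩
  have := (hB a).unique (y₁ := (e.1, a')) (y₂ := (1, a)) e.2.2 ⟨ha, by simp⟩
  exact e.2.1 (congrArg Prod.fst this)

/-- The lift of `φ` to the semidirect product given by the coboundary of `v`. -/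
def coboundaryHom (φ : P →* G) (v : A → X) : P →* (A → X) ⋊[mulAutArrow] G :=
  (MulAut.conj (SemidirectProduct.inl v)).toMonoidHom.comp (SemidirectProduct.inr.comp φ)

theorem coboundaryHom_left (φ : P →* G) (v : A → X) (g : P) (b : A) :
    (coboundaryHom φ v g).left b = v b * (v ((φ g)⁻¹ • b))⁻¹ := by
  simp [coboundaryHom]
  rfl

theorem coboundaryHom_right (φ : P →* G) (v : A → X) (g : P) :
    (coboundaryHom φ v g).right = φ g := by
  simp [coboundaryHom]

theorem coboundaryHom_basePotential_left {φ : P →* G} {B : Set A} (hB : IsBaseSet φ B)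
    (f : ∀ a b : A, BaseEdge φ B a b → X) {a b : A} (e : BaseEdge φ B a b) :
    (coboundaryHom φ (basePotential φ B f) e.1).left b = f a b e := by
  rw [coboundaryHom_left, inv_smul_eq_iff.mpr e.2.2.2.symm, basePotential_base hB f e.2.2.1,
    basePotential_eq hB f e, inv_one, mul_one]

/-- The arrow of the action groupoid given by a group element. -/
def smulArrow {a b : A} (g : G) (h : g • a = b) : objEquiv G A a ⟶ objEquiv G A b :=
  ⟨g, h⟩

/-- Gives uniqueness of the lift: an arrow c → b of `P` is determined by the arrows to c and to b
from their common base point. -/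
theorem curry_comp_eq_coboundaryHom {φ : P →* G} {B : Set A} (hB : IsBaseSet φ B)
    (f : ∀ a b : A, BaseEdge φ B a b → X) (E : ActionCategory G A ⥤ SingleObj X)
    (hE : ∀ (a b : A) (e : BaseEdge φ B a b),
      E.map (smulArrow (φ e.1) e.2.2.2) = f a b e) :
    (curry E).comp φ = coboundaryHom φ (basePotential φ B f) := by
  have key : ∀ (a b : A) (g : P) (_ : a ∈ B) (h : φ g • a = b),
      E.map (smulArrow (φ g) h) =
        basePotential φ B f b := by
    intro a b g ha h
    by_cases hg : g = 1
    · subst hg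
      obtain rfl : a = b := by simpa using h
      rw [basePotential_base hB f ha]
      have : smulArrow (φ 1) h = 𝟙 _ :=
        Subtype.ext (map_one φ)
      rw [this, E.map_id]
      rfl
    · rw [basePotential_eq hB f ⟨g, hg, ha, h⟩]
      exact hE a b ⟨g, hg, ha, h⟩
  refine MonoidHom.ext fun p => SemidirectProduct.ext (funext fun b => ?_) ?_
  · rw [coboundaryHom_left]
    obtain ⟨⟨g, a⟩, ⟨ha, hga⟩, -⟩ := hB ((φ p)⁻¹ • b)
    have hb : φ (p * g) • a = b := by
      rw [map_mul, mul_smul]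
      exact (congrArg (φ p • ·) hga).trans (smul_inv_smul _ _)
    have h₁ := key a _ g ha hga
    have h₂ := key a b (p * g) ha hb
    have hc : smulArrow (φ (p * g)) hb =
        smulArrow (φ g) hga ≫ homOfPair b (φ p) := Subtype.ext (map_mul φ p g)
    have h₃ := (E.map_comp _ _).symm.trans ((congrArg E.map hc).symm.trans h₂)
    rw [← h₁, ← h₃]
    exact (mul_inv_cancel_right _ _).symm
  · rw [coboundaryHom_right]
    rfl

/-! ### Free subgroups of a free product -/

variable {Q : Type u} [Group Q]

open Monoid.Coprod in
/-- If `P` and `Q` both act freely, then the action groupoid of `P ∗ Q` is free. -/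
theorem nonempty_isFreeGroupoid [MulAction (Monoid.Coprod P Q) A]
    (hP : ∀ (g : P) (x : A), (inl g : Monoid.Coprod P Q) • x = x → g = 1)
    (hQ : ∀ (g : Q) (x : A), (inr g : Monoid.Coprod P Q) • x = x → g = 1) :
    Nonempty (IsFreeGroupoid (ActionCategory (Monoid.Coprod P Q) A)) := by
  obtain ⟨B, hB⟩ := exists_isBaseSet (inl : P →* Monoid.Coprod P Q) hP
  obtain ⟨C, hC⟩ := exists_isBaseSet (inr : Q →* Monoid.Coprod P Q) hQ
  refine ⟨
    { quiverGenerators :=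
        ⟨fun a b => BaseEdge (inl : P →* Monoid.Coprod P Q) B a.back b.back ⊕
          BaseEdge (inr : Q →* Monoid.Coprod P Q) C a.back b.back⟩
      of := fun {a b} e => Sum.casesOn e (fun e => ⟨inl e.1, e.2.2.2⟩) (fun e => ⟨inr e.1, e.2.2.2⟩)
      unique_lift := ?_ }⟩
  intro X _ f
  let fP : ∀ a b : A, BaseEdge (inl : P →* Monoid.Coprod P Q) B a b → X :=
    fun a b e => @f ⟨(), a⟩ ⟨(), b⟩ (Sum.inl e)
  let fQ : ∀ a b : A, BaseEdge (inr : Q →* Monoid.Coprod P Q) C a b → X :=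
    fun a b e => @f ⟨(), a⟩ ⟨(), b⟩ (Sum.inr e)
  let F : Monoid.Coprod P Q →* (A → X) ⋊[mulAutArrow] Monoid.Coprod P Q :=
    lift (coboundaryHom (inl : P →* Monoid.Coprod P Q) (basePotential _ B fP))
      (coboundaryHom (inr : Q →* Monoid.Coprod P Q) (basePotential _ C fQ))
  -- Only homomorphisms over the identity of `P ∗ Q` come from functors.
  have hF : ∀ g, (F g).right = g := by
    suffices SemidirectProduct.rightHom.comp F = MonoidHom.id _ from DFunLike.ext_iff.mp this
    refine hom_ext (MonoidHom.ext fun g => ?_) (MonoidHom.ext fun g => ?_)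
    · simp [F, coboundaryHom_right]
    · simp [F, coboundaryHom_right]
  refine ⟨uncurry F hF, ?_, ?_⟩
  · rintro ⟨⟨⟩, a : A⟩ ⟨⟨⟩, b : A⟩ (e | e)
    · have h : F (inl e.1) = _ := lift_apply_inl _ _ _
      exact (congrFun (congrArg SemidirectProduct.left h) b).trans
        (coboundaryHom_basePotential_left hB fP e)
    · have h : F (inr e.1) = _ := lift_apply_inr _ _ _
      exact (congrFun (congrArg SemidirectProduct.left h) b).trans
        (coboundaryHom_basePotential_left hC fQ e)
  · intro E hE
    have hcurry : curry E = F := by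
      refine hom_ext ?_ ?_
      · rw [lift_comp_inl]
        exact curry_comp_eq_coboundaryHom hB fP E fun a b e => hE ⟨(), a⟩ ⟨(), b⟩ (Sum.inl e)
      · rw [lift_comp_inr]
        exact curry_comp_eq_coboundaryHom hC fQ E fun a b e => hE ⟨(), a⟩ ⟨(), b⟩ (Sum.inr e)
    apply Functor.hext
    · intro
      apply Unit.ext
    · refine ActionCategory.cases ?_
      intro t g
      apply heq_of_eq
      change E.map (homOfPair t g) = (F g).left t
      rw [← hcurry]
      rfl

open Monoid.Coprod in
/-- A subgroup of a free product is free if both factors act freely on its cosets. -/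
theorem isFreeGroup_of_free_smul_quotient (Γ : Subgroup (Monoid.Coprod P Q))
    (hP : ∀ (g : P) (x : Monoid.Coprod P Q ⧸ Γ), (inl g : Monoid.Coprod P Q) • x = x → g = 1)
    (hQ : ∀ (g : Q) (x : Monoid.Coprod P Q ⧸ Γ), (inr g : Monoid.Coprod P Q) • x = x → g = 1) :
    IsFreeGroup Γ := by
  obtain ⟨_⟩ := nonempty_isFreeGroupoid hP hQ
  -- The vertex group at the trivial coset is its stabilizer `Γ`.
  let r := objEquiv (Monoid.Coprod P Q) (Monoid.Coprod P Q ⧸ Γ) ((1 : Monoid.Coprod P Q) : _ ⧸ Γ)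
  have hconn : IsConnected (ActionCategory (Monoid.Coprod P Q) (Monoid.Coprod P Q ⧸ Γ)) :=
    inferInstance
  have hfree := @IsFreeGroupoid.endIsFreeOfConnectedFree _ _ (by exact hconn) _ r
  exact @IsFreeGroup.ofMulEquiv _ _ hfree _ _ (by exact endMulEquivSubgroup Γ)

/-- A group of finite order acts freely on the cosets of a free subgroup. -/
theorem eq_one_of_smul_quotient_eq [Finite P] (φ : P →* G) (hφ : Function.Injective φ)
    (Γ : Subgroup G) [IsFreeGroup Γ] (g : P) (x : G ⧸ Γ) (h : φ g • x = x) : g = 1 := by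
  induction x using QuotientGroup.induction_on with
  | H z =>
    have hmem : z⁻¹ * φ g * z ∈ Γ := by
      have := QuotientGroup.eq.mp (show ((z : G) : G ⧸ Γ) = ((φ g * z : G) : G ⧸ Γ) from h.symm)
      simpa [mul_assoc] using this
    have hfin : IsOfFinOrder (⟨_, hmem⟩ : Γ) := by
      obtain ⟨n, hn, hgn⟩ := (isOfFinOrder_iff_pow_eq_one.mp (isOfFinOrder_of_finite g))
      refine isOfFinOrder_iff_pow_eq_one.mpr ⟨n, hn, Subtype.ext ?_⟩
      change (z⁻¹ * φ g * z) ^ n = 1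
      have := conj_pow (i := n) (a := z⁻¹) (b := φ g)
      rw [inv_inv, ← map_pow, hgn] at this
      simpa using this
    have hone : (⟨_, hmem⟩ : Γ) = 1 := by
      have htf : IsMulTorsionFree Γ :=
        (IsFreeGroup.mulEquiv Γ).symm.injective.isMulTorsionFree (IsFreeGroup.mulEquiv Γ).symm.toMonoidHom
      by_contra hne
      exact not_isOfFinOrder_of_isMulTorsionFree hne hfin
    have := congrArg Subtype.val hone
    have hg : φ g = 1 := by
      have h2 : z⁻¹ * φ g * z = 1 := this
      have := congrArg (fun t => z * t * z⁻¹) h2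
      simpa [mul_assoc] using this
    exact hφ (by rw [hg, map_one])

end FreeAction

/-! ### Cycle lengths and free actions of cyclic groups -/

section CyclicHom

variable {D : Type} {m : ℕ}

/-- The action of a cyclic group of order `m` generated by a permutation `e` with `e ^ m = 1`. -/
def cyclicHom (e : Equiv.Perm D) (he : e ^ m = 1) :
    Multiplicative (ZMod m) →* Equiv.Perm D :=
  AddMonoidHom.toMultiplicativeLeft (ZMod.lift m ⟨zmultiplesHom (Additive (Equiv.Perm D))
    (Additive.ofMul e), by
      rw [zmultiplesHom_apply, natCast_zsmul, ← ofMul_pow, he, ofMul_one]⟩)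

theorem cyclicHom_ofAdd_intCast (e : Equiv.Perm D) (he : e ^ m = 1) (k : ℤ) :
    cyclicHom e he (Multiplicative.ofAdd (k : ZMod m)) = e ^ k := by
  exact congrArg Additive.toMul (ZMod.lift_coe m _ k)

theorem cyclicHom_ofAdd_one (e : Equiv.Perm D) (he : e ^ m = 1) :
    cyclicHom e he (Multiplicative.ofAdd 1) = e := by
  simpa using cyclicHom_ofAdd_intCast e he 1

theorem exists_eq_ofAdd_one_pow [NeZero m] (g : Multiplicative (ZMod m)) :
    ∃ k : ℕ, g = Multiplicative.ofAdd (1 : ZMod m) ^ k := by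
  refine ⟨(Multiplicative.toAdd g).val, ?_⟩
  rw [← ofAdd_nsmul, nsmul_one, ZMod.natCast_zmod_val]
  rfl

theorem ofAdd_one_pow_eq_one_iff (k : ℕ) :
    Multiplicative.ofAdd (1 : ZMod m) ^ k = 1 ↔ m ∣ k := by
  rw [← ofAdd_nsmul, nsmul_one, ofAdd_eq_one, ZMod.natCast_eq_zero_iff]

theorem hom_ext_ofAdd_one [NeZero m] {M : Type*} [Monoid M] {f g : Multiplicative (ZMod m) →* M}
    (h : f (Multiplicative.ofAdd 1) = g (Multiplicative.ofAdd 1)) : f = g := by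
  refine MonoidHom.ext fun x => ?_
  obtain ⟨k, rfl⟩ := exists_eq_ofAdd_one_pow x
  rw [map_pow, map_pow, h]

theorem pow_eq_one_of_minimalPeriod {e : Equiv.Perm D}
    (he : ∀ d, Function.minimalPeriod e d = m) : e ^ m = 1 := by
  ext d
  have h := Function.isPeriodicPt_minimalPeriod e d
  rw [he, Function.IsPeriodicPt, Equiv.Perm.iterate_eq_pow] at h
  exact h

/-- All cycles of a permutation representing the generator of a cyclic group of order `m` have
length `m` exactly when the group acts freely. -/
theorem minimalPeriod_eq_iff_free [NeZero m] (f : Multiplicative (ZMod m) →* Equiv.Perm D) :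
    (∀ d, Function.minimalPeriod (f (Multiplicative.ofAdd 1)) d = m) ↔
      ∀ g d, f g d = d → g = 1 := by
  have key : ∀ (k : ℕ) (d : D),
      Function.minimalPeriod (f (Multiplicative.ofAdd 1)) d ∣ k ↔
        f (Multiplicative.ofAdd 1 ^ k) d = d := fun k d => by
    rw [← Function.isPeriodicPt_iff_minimalPeriod_dvd, Function.IsPeriodicPt,
      Equiv.Perm.iterate_eq_pow, map_pow]
    rfl
  constructor
  · intro h g d hg
    obtain ⟨k, rfl⟩ := exists_eq_ofAdd_one_pow g
    rw [ofAdd_one_pow_eq_one_iff, ← h d]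
    exact (key k d).mpr hg
  · intro h d
    refine Nat.dvd_antisymm ((key m d).mpr ?_) ?_
    · rw [(ofAdd_one_pow_eq_one_iff m).mpr dvd_rfl, map_one]
      rfl
    · exact (ofAdd_one_pow_eq_one_iff _).mp (h _ d ((key _ d).mp dvd_rfl))

end CyclicHom

/-! ### Rooted hypermaps and root stabilizers -/

namespace RootedPQHypermap

open Monoid.Coprod

variable {p q n : ℕ}

/-- The action of `ℤ_p * ℤ_q` on the darts: the generators act as `α` and `φ`. -/
def action (H : RootedPQHypermap p q n) : CyclicFreeProduct p q →* Equiv.Perm (Fin n) :=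
  lift (cyclicHom H.map.edge (pow_eq_one_of_minimalPeriod H.isPQ.1))
    (cyclicHom H.map.face (pow_eq_one_of_minimalPeriod H.isPQ.2))

theorem action_inl_one (H : RootedPQHypermap p q n) :
    H.action (inl (Multiplicative.ofAdd 1)) = H.map.edge := by
  rw [action, lift_apply_inl, cyclicHom_ofAdd_one]

theorem action_inr_one (H : RootedPQHypermap p q n) :
    H.action (inr (Multiplicative.ofAdd 1)) = H.map.face := by
  rw [action, lift_apply_inr, cyclicHom_ofAdd_one]

theorem action_generators_mul_inv (H : RootedPQHypermap p q n) :
    H.action (inl (Multiplicative.ofAdd 1) * inr (Multiplicative.ofAdd 1))⁻¹ = H.map.vertex := by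
  rw [map_inv, map_mul, action_inl_one, action_inr_one, Hypermap.face]
  group

theorem exists_action_root (H : RootedPQHypermap p q n) (d : Fin n) :
    ∃ g, H.action g H.root = d := by
  have hle : Subgroup.closure ({H.map.edge, H.map.vertex} : Set (Equiv.Perm (Fin n))) ≤
      H.action.range := by
    rw [Subgroup.closure_le]
    rintro _ (rfl | rfl)
    · exact ⟨_, H.action_inl_one⟩
    · exact ⟨_, H.action_generators_mul_inv⟩
  obtain ⟨⟨s, hs⟩, hsd⟩ := H.map.transitive.exists_smul_eq H.root d
  obtain ⟨g, rfl⟩ := hle hs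
  exact ⟨g, hsd⟩

/-- The subgroup of `ℤ_p * ℤ_q` fixing the root. -/
def rootStabilizer (H : RootedPQHypermap p q n) : Subgroup (CyclicFreeProduct p q) :=
  (MulAction.stabilizer (Equiv.Perm (Fin n)) H.root).comap H.action

theorem mem_rootStabilizer (H : RootedPQHypermap p q n) (g : CyclicFreeProduct p q) :
    g ∈ H.rootStabilizer ↔ H.action g H.root = H.root := Iff.rfl

theorem action_root_eq_iff (H : RootedPQHypermap p q n) (g h : CyclicFreeProduct p q) :
    H.action g H.root = H.action h H.root ↔ g⁻¹ * h ∈ H.rootStabilizer := by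
  rw [mem_rootStabilizer, map_mul, map_inv, Equiv.Perm.mul_apply, Equiv.Perm.inv_eq_iff_eq, eq_comm]

theorem index_rootStabilizer (H : RootedPQHypermap p q n) : H.rootStabilizer.index = n := by
  let _ : MulAction (CyclicFreeProduct p q) (Fin n) := MulAction.compHom _ H.action
  have htrans : MulAction.IsPretransitive (CyclicFreeProduct p q) (Fin n) := ⟨fun x y => by
    obtain ⟨g, hg⟩ := H.exists_action_root x
    obtain ⟨h, hh⟩ := H.exists_action_root y
    refine ⟨h * g⁻¹, ?_⟩
    change H.action (h * g⁻¹) x = y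
    rw [← hg, ← hh, ← Equiv.Perm.mul_apply, ← map_mul, inv_mul_cancel_right]⟩
  have := MulAction.index_stabilizer_of_transitive (CyclicFreeProduct p q) H.root
  rwa [Nat.card_fin] at this

theorem free_smul_quotient_rootStabilizer (H : RootedPQHypermap p q n) {P : Type} [Group P]
    (φ : P →* CyclicFreeProduct p q)
    (hφ : ∀ g d, (H.action.comp φ) g d = d → g = 1)
    (g : P) (x : CyclicFreeProduct p q ⧸ H.rootStabilizer) (hx : φ g • x = x) : g = 1 := by
  induction x using QuotientGroup.induction_on with
  | H z =>
    have h := QuotientGroup.eq.mp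
      (show ((z : CyclicFreeProduct p q) : _ ⧸ H.rootStabilizer) =
        ((φ g * z : CyclicFreeProduct p q) : _ ⧸ H.rootStabilizer) from hx.symm)
    rw [← action_root_eq_iff, map_mul] at h
    exact hφ g _ h.symm

theorem isFreeGroup_rootStabilizer [NeZero p] [NeZero q] (H : RootedPQHypermap p q n) :
    IsFreeGroup H.rootStabilizer := by
  refine isFreeGroup_of_free_smul_quotient _ (H.free_smul_quotient_rootStabilizer inl ?_)
    (H.free_smul_quotient_rootStabilizer inr ?_)
  · refine (minimalPeriod_eq_iff_free _).mp fun d => ?_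
    rw [MonoidHom.comp_apply, action_inl_one]
    exact H.isPQ.1 d
  · refine (minimalPeriod_eq_iff_free _).mp fun d => ?_
    rw [MonoidHom.comp_apply, action_inr_one]
    exact H.isPQ.2 d

theorem rootStabilizer_mem [NeZero p] [NeZero q] (H : RootedPQHypermap p q n) :
    H.rootStabilizer ∈ freeSubgroupsOfIndex p q n := by
  refine ⟨⟨?_⟩, H.index_rootStabilizer, H.isFreeGroup_rootStabilizer⟩
  rw [index_rootStabilizer]
  -- The root forces n > 0, so index n is a genuine finite index.
  exact (Fin.pos H.root).ne'

theorem Iso.rootStabilizer_eq [NeZero p] [NeZero q] {H₁ H₂ : RootedPQHypermap p q n}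
    (h : Iso H₁ H₂) : H₁.rootStabilizer = H₂.rootStabilizer := by
  obtain ⟨ψ, he, hv, hr⟩ := h
  have hf : ψ * H₁.map.face * ψ⁻¹ = H₂.map.face := by
    rw [Hypermap.face, Hypermap.face, ← he, ← hv]
    group
  have hact : (MulAut.conj ψ).toMonoidHom.comp H₁.action = H₂.action := by
    refine hom_ext (hom_ext_ofAdd_one ?_) (hom_ext_ofAdd_one ?_)
    · simpa [action_inl_one] using he
    · simpa [action_inr_one] using hf
  ext g
  rw [mem_rootStabilizer, mem_rootStabilizer, ← hact, ← hr]
  simp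

theorem iso_of_rootStabilizer_eq {H₁ H₂ : RootedPQHypermap p q n}
    (h : H₁.rootStabilizer = H₂.rootStabilizer) : Iso H₁ H₂ := by
  choose s hs using H₁.exists_action_root
  let f : Fin n → Fin n := fun d => H₂.action (s d) H₂.root
  -- Equal stabilizers make `f` independent of the choice of `s`.
  have hf : ∀ g, f (H₁.action g H₁.root) = H₂.action g H₂.root := fun g => by
    rw [action_root_eq_iff, ← h, ← action_root_eq_iff, hs]
  have hinj : Function.Injective f := fun d e hde => by
    rw [← hs d, ← hs e, action_root_eq_iff, h, ← action_root_eq_iff]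
    exact hde
  let ψ : Equiv.Perm (Fin n) := Equiv.ofBijective f (Finite.injective_iff_bijective.mp hinj)
  have hψ : ∀ k, ψ * H₁.action k * ψ⁻¹ = H₂.action k := fun k => by
    rw [mul_inv_eq_iff_eq_mul]
    ext d : 1
    obtain ⟨g, rfl⟩ := H₁.exists_action_root d
    change f (H₁.action k (H₁.action g _)) = H₂.action k (f (H₁.action g _))
    rw [hf, ← Equiv.Perm.mul_apply, ← map_mul, hf, map_mul, Equiv.Perm.mul_apply]
  refine ⟨ψ, ?_, ?_, ?_⟩
  · rw [← action_inl_one, ← action_inl_one, hψ]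
  · rw [← action_generators_mul_inv, ← action_generators_mul_inv, hψ]
  · have h₁ := hf 1
    rwa [map_one, map_one] at h₁

theorem exists_action_eq [NeZero p] [NeZero q] (ρ : CyclicFreeProduct p q →* Equiv.Perm (Fin n))
    (r : Fin n) (htrans : ∀ d, ∃ g, ρ g r = d) (hp : ∀ g d, (ρ.comp inl) g d = d → g = 1)
    (hq : ∀ g d, (ρ.comp inr) g d = d → g = 1) :
    ∃ H : RootedPQHypermap p q n, H.action = ρ ∧ H.root = r := by
  obtain ⟨α, hα⟩ : ∃ α, α = ρ (inl (Multiplicative.ofAdd 1)) := ⟨_, rfl⟩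
  obtain ⟨β, hβ⟩ : ∃ β, β = ρ (inr (Multiplicative.ofAdd 1)) := ⟨_, rfl⟩
  -- The vertex permutation must be `(α * β)⁻¹` for the face permutation to be `β`.
  have hface : α⁻¹ * ((α * β)⁻¹)⁻¹ = β := by group
  have hle : ρ.range ≤ Subgroup.closure {α, (α * β)⁻¹} := by
    have ha : α ∈ Subgroup.closure {α, (α * β)⁻¹} := Subgroup.subset_closure (by simp)
    have hv : (α * β)⁻¹ ∈ Subgroup.closure {α, (α * β)⁻¹} := Subgroup.subset_closure (by simp)
    have hb : β ∈ Subgroup.closure {α, (α * β)⁻¹} := by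
      have := mul_mem (inv_mem ha) (inv_mem hv)
      rwa [hface] at this
    rw [range_eq, sup_le_iff]
    constructor
    · rintro _ ⟨g, rfl⟩
      obtain ⟨k, rfl⟩ := exists_eq_ofAdd_one_pow g
      rw [map_pow, MonoidHom.comp_apply, ← hα]
      exact pow_mem ha k
    · rintro _ ⟨g, rfl⟩
      obtain ⟨k, rfl⟩ := exists_eq_ofAdd_one_pow g
      rw [map_pow, MonoidHom.comp_apply, ← hβ]
      exact pow_mem hb k
  let M : Hypermap (Fin n) :=
    { edge := α
      vertex := (α * β)⁻¹
      transitive := ⟨fun x y => by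
        obtain ⟨g, hg⟩ := htrans x
        obtain ⟨h, hh⟩ := htrans y
        refine ⟨⟨ρ (h * g⁻¹), hle ⟨_, rfl⟩⟩, ?_⟩
        change ρ (h * g⁻¹) x = y
        rw [← hg, ← hh, ← Equiv.Perm.mul_apply, ← map_mul, inv_mul_cancel_right]⟩ }
  have hM : M.face = β := hface
  have hPQ : M.IsPQ p q := by
    constructor
    · have := (minimalPeriod_eq_iff_free (ρ.comp inl)).mpr hp
      rwa [MonoidHom.comp_apply, ← hα] at this
    · have := (minimalPeriod_eq_iff_free (ρ.comp inr)).mpr hq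
      rwa [MonoidHom.comp_apply, ← hβ, ← hM] at this
  let H : RootedPQHypermap p q n := ⟨M, hPQ, r⟩
  refine ⟨H, hom_ext (hom_ext_ofAdd_one ?_) (hom_ext_ofAdd_one ?_), rfl⟩
  · exact H.action_inl_one.trans hα
  · exact H.action_inr_one.trans (hM.trans hβ)

theorem exists_rootStabilizer_eq [NeZero p] [NeZero q] {Γ : Subgroup (CyclicFreeProduct p q)}
    (hΓ : Γ ∈ freeSubgroupsOfIndex p q n) :
    ∃ H : RootedPQHypermap p q n, H.rootStabilizer = Γ := by
  obtain ⟨hfin, hindex, hfree⟩ := hΓ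
  let ε : CyclicFreeProduct p q ⧸ Γ ≃ Fin n := Finite.equivFinOfCardEq hindex
  obtain ⟨ρ, hρ⟩ : ∃ ρ : CyclicFreeProduct p q →* Equiv.Perm (Fin n),
      ∀ g x, ρ g (ε x) = ε (g • x) :=
    ⟨ε.permCongrHom.toMonoidHom.comp (MulAction.toPermHom _ (CyclicFreeProduct p q ⧸ Γ)),
      fun g x => by simp [Equiv.permCongrHom]⟩
  have hρr : ∀ g, ρ g (ε ((1 : CyclicFreeProduct p q) : _ ⧸ Γ)) =
      ε ((g : CyclicFreeProduct p q) : _ ⧸ Γ) := fun g => by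
    rw [hρ]
    exact congrArg (fun t : CyclicFreeProduct p q => ε t) (mul_one g)
  have hφ : ∀ {P : Type} [Group P] [Finite P] (φ : P →* CyclicFreeProduct p q),
      Function.Injective φ → ∀ g d, (ρ.comp φ) g d = d → g = 1 := by
    intro P _ _ φ hinj g d hg
    obtain ⟨x, rfl⟩ := ε.surjective d
    rw [MonoidHom.comp_apply, hρ, ε.apply_eq_iff_eq] at hg
    exact eq_one_of_smul_quotient_eq φ hinj Γ g x hg
  obtain ⟨H, hact, hroot⟩ := exists_action_eq ρ (ε ((1 : CyclicFreeProduct p q) : _ ⧸ Γ))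
    (fun d => by
      obtain ⟨g, hg⟩ := QuotientGroup.mk_surjective (ε.symm d)
      exact ⟨g, by rw [hρr, hg, ε.apply_symm_apply]⟩)
    (hφ inl inl_injective) (hφ inr inr_injective)
  refine ⟨H, ?_⟩
  ext g
  rw [mem_rootStabilizer, hact, hroot, hρr, ε.apply_eq_iff_eq, eq_comm, QuotientGroup.eq, inv_one,
    one_mul]

theorem finite (p q n : ℕ) : Finite (RootedPQHypermap p q n) := by
  refine Finite.of_injective
    (fun H : RootedPQHypermap p q n => (H.map.edge, H.map.vertex, H.root)) ?_
  rintro ⟨⟨e₁, v₁, _⟩, _, r₁⟩ ⟨⟨e₂, v₂, _⟩, _, r₂⟩ h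
  simp only [Prod.mk.injEq] at h
  obtain ⟨rfl, rfl, rfl⟩ := h
  rfl

end RootedPQHypermap

/-- Rooted `(p,q)`-hypermaps correspond to free subgroups of finite index: take the stabilizer of
the root. -/
noncomputable def rootedHypermapClassEquiv (p q n : ℕ) [NeZero p] [NeZero q] :
    RootedHypermapClass p q n ≃ freeSubgroupsOfIndex p q n :=
  Equiv.ofBijective
    (Quotient.lift (fun H => ⟨H.rootStabilizer, H.rootStabilizer_mem⟩)
      fun _ _ h => Subtype.ext (RootedPQHypermap.Iso.rootStabilizer_eq h))
    ⟨by
      rintro ⟨H₁⟩ ⟨H₂⟩ h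
      exact Quotient.sound (RootedPQHypermap.iso_of_rootStabilizer_eq (congrArg Subtype.val h)), by
      rintro ⟨Γ, hΓ⟩
      obtain ⟨H, rfl⟩ := RootedPQHypermap.exists_rootStabilizer_eq hΓ
      exact ⟨Quotient.mk _ H, rfl⟩⟩

theorem mainTheorem2 (p q : ℕ) (hpq : 6 ≤ p * q) :
    (∀ n : ℕ, (freeSubgroupsOfIndex p q n).Finite) ∧
    (∀ n : ℕ, Finite (RootedHypermapClass p q n)) ∧
    freeSubgroupSeries p q = rootedHypermapSeries p q := by
  have : NeZero p := ⟨by rintro rfl; simp at hpq⟩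
  have : NeZero q := ⟨by rintro rfl; simp at hpq⟩
  have hfin : ∀ n, Finite (RootedHypermapClass p q n) := fun n => by
    have := RootedPQHypermap.finite p q n
    exact Quotient.finite _
  refine ⟨fun n => ?_, hfin, ?_⟩
  · have := hfin n
    exact Set.finite_coe_iff.mp (Finite.of_equiv _ (rootedHypermapClassEquiv p q n))
  · ext n
    rw [freeSubgroupSeries, rootedHypermapSeries, PowerSeries.coeff_mk, PowerSeries.coeff_mk,
      Nat.card_congr (rootedHypermapClassEquiv p q n), Nat.card_coe_set_eq]
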